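/- Let $\omega\subset\mathbb R^2$ be a non-empty bounded domain (open, connected) with Lipschitz boundary, let $h:\overline\omega\to\mathbb R$ be Lipschitz continuous and bounded above and below by positive constants, and let $$\Omega=\{(x',x_3)\in\mathbb R^2\times\mathbb R:\ x'\in\omega,\ 0<x_3<h(x')\}.$$ Let $\Gamma_0=\{x\in\overline\Omega: x_3=0\}$, $\Gamma_1=\{x\in\overline\Omega: x_3=h(x')\}$, let $\Gamma_L=\{x\in\overline\Omega: x'\in\partial\omega\}$ be the lateral part of $\partial\Omega$, and let $n$ be the outward unit normal. Let $p\in(1,\infty)$ and $q\in[1,\infty)$ be real. Define $$V^p_{0.div}=\{\varphi\in W^{1,p}(\Omega)^3:\ \varphi=0\text{ on }\Gamma_1\cup\Gamma_L,\ \varphi\cdot n=0\text{ on }\Gamma_0,\ \operatorname{div}\varphi=0\text{ in }\Omega\},$$ with boundary values in the sense of traces, and with the norm $\|\varphi\|_{1.p}=\left(\int_\Omega|\nabla\varphi|^p\,dx\right)^{1/p}$. Let $D(\varphi)=\frac12(\nabla\varphi+\nabla\varphi^{T})$, let $A:B=\sum_{i,j}A_{ij}B_{ij}$ for $3\times3$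 matrices, and let $|\cdot|$ be the Euclidean norm on vectors and on matrices. Let $\mu:\mathbb R\times\mathbb R^3\times\mathbb R_+\to\mathbb R$ be continuous, let $d\mapsto\mu(o,e,d)$ be monotone increasing (non-decreasing) on $\mathbb R_+$ for all $(o,e)$, and let there be real numbers $\mu_0,\mu_1$ with $0<\mu_0\le\mu(o,e,d)\le\mu_1$ for all $(o,e,d)$. Define $$\mathcal F(\lambda_0,\lambda_1,\lambda_2)=2\mu(\lambda_0,\lambda_1,|\lambda_2|)\,|\lambda_2|^{p-2}\lambda_2\ \text{ if }\lambda_2\neq0,\qquad \mathcal F(\lambda_0,\lambda_1,0)=0,$$ for $(\lambda_0,\lambda_1,\lambda_2)\in\mathbb R\times\mathbb R^3\times\mathbb R^{3\times3}$. Let $G\in W^{1,p}(\Omega)^3$ satisfy $\operatorname{div}G=0$ in $\Omega$, $G=0$ on $\Gamma_1$ and $G\cdot n=0$ on $\Gamma_0$. Then for every $\theta\in L^q(\Omega)$ and $\upsilon\in L^p(\Omega)^3$ the formula $$\langle \mathbf A_{\theta,\upsilon}(\tilde\upsilon),\varphi\rangle=\int_\Omega\mathcal F\bigl(\theta,\upsilon+G,D(\tilde\upsilon+G)\bigr):D(\varphi)\,dx,\qquad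 \tilde\upsilon,\varphi\in V^p_{0.div},$$ (where the integrand is integrable) defines an operator $\mathbf A_{\theta,\upsilon}:V^p_{0.div}\to(V^p_{0.div})'$ that is - bounded: it maps bounded sets to bounded sets; and - pseudo-monotone: whenever $u_k\rightharpoonup u$ weakly in $V^p_{0.div}$ and $\limsup_{k}\langle\mathbf A_{\theta,\upsilon}(u_k),u_k-u\rangle\le0$, then $\liminf_k\langle\mathbf A_{\theta,\upsilon}(u_k),u_k-v\rangle\ge\langle\mathbf A_{\theta,\upsilon}(u),u-v\rangle$ for all $v\in V^p_{0.div}$. -/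

import Mathlib

open MeasureTheory Filter Topology Set
open scoped NNReal ENNReal

namespace FluidFlow

noncomputable section

/-- Points of the plane. -/
abbrev E2 := EuclideanSpace ℝ (Fin 2)

/-- Points and vectors of space, with the Euclidean norm. -/
abbrev E3 := EuclideanSpace ℝ (Fin 3)

/-- Real `3 × 3` matrices, with the Euclidean (Frobenius) norm and the inner product
`A : B = ∑ i j, A i j * B i j`. -/
abbrev Mat3 := EuclideanSpace ℝ (Fin 3 × Fin 3)

instance fact_one_le_ofReal (p : ℝ) [hp : Fact (1 < p)] : Fact (1 ≤ ENNReal.ofReal p) :=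
  ⟨by simpa using ENNReal.ofReal_le_ofReal hp.out.le⟩

/-! ### The geometry -/

/-- Lipschitz boundary: near each boundary point, and in suitable orthonormal coordinates, `U` is
the region above the graph of a Lipschitz function. -/
def HasLipschitzBoundary (U : Set E2) : Prop :=
  ∀ x ∈ frontier U, ∃ r > 0, ∃ (L : E2 ≃ₗᵢ[ℝ] E2) (γ : ℝ → ℝ) (K : ℝ≥0),
    LipschitzWith K γ ∧ ∀ y ∈ Metric.ball x r, (y ∈ U ↔ γ (L y 0) < L y 1)

/-- The horizontal part `x' = (x₁, x₂)` of a point `x = (x', x₃)`. -/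
def hor (x : E3) : E2 := !₂[x 0, x 1]

/-- `Ω = {(x', x₃) : x' ∈ U, 0 < x₃ < h x'}`. -/
def dom (U : Set E2) (h : E2 → ℝ) : Set E3 :=
  {x | hor x ∈ U ∧ 0 < x 2 ∧ x 2 < h (hor x)}

/-- The bottom `Γ₀`. -/
def bottom (U : Set E2) (h : E2 → ℝ) : Set E3 := {x | x ∈ closure (dom U h) ∧ x 2 = 0}

/-- The top `Γ₁`. -/
def top (U : Set E2) (h : E2 → ℝ) : Set E3 := {x | x ∈ closure (dom U h) ∧ x 2 = h (hor x)}

/-- The lateral boundary `Γ_L`. -/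
def lateral (U : Set E2) (h : E2 → ℝ) : Set E3 :=
  {x | x ∈ closure (dom U h) ∧ hor x ∈ frontier U}

/-- The outward unit normal to `Ω` on the bottom `Γ₀`. -/
def bottomNormal : E3 := !₂[0, 0, -1]

/-- Lebesgue measure on `Ω`. -/
abbrev vol (Ω : Set E3) : Measure E3 := volume.restrict Ω

/-- Surface measure on `∂Ω`. -/
abbrev surf (Ω : Set E3) : Measure E3 :=
  (Measure.euclideanHausdorffMeasure 2 : Measure E3).restrict (frontier Ω)

/-! ### Sobolev spaces of vector fields -/

/-- `L^p(Ω)³`. -/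
abbrev LpVec (p : ℝ) (Ω : Set E3) := Lp E3 (ENNReal.ofReal p) (vol Ω)

/-- `L^p(Ω)^{3 × 3}`. -/
abbrev LpMat (p : ℝ) (Ω : Set E3) := Lp Mat3 (ENNReal.ofReal p) (vol Ω)

/-- `L^p(∂Ω)³`. -/
abbrev LpBdry (p : ℝ) (Ω : Set E3) := Lp E3 (ENNReal.ofReal p) (surf Ω)

/-- The classical gradient `(∂ψ_i/∂x_j)_{ij}` of a differentiable vector field. -/
def jac (ψ : E3 → E3) (x : E3) : Mat3 :=
  WithLp.toLp 2 fun ij => fderiv ℝ ψ x (EuclideanSpace.single ij.2 1) ij.1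

/-- `J` is the weak gradient of `u` on `Ω`: `∫ u_i ∂_j ψ = - ∫ J_ij ψ` for all `ψ` in
`C_c^∞(Ω)`. -/
def IsWeakGradient (Ω : Set E3) (u : E3 → E3) (J : E3 → Mat3) : Prop :=
  ∀ ψ : E3 → ℝ, ContDiff ℝ ((⊤ : ℕ∞) : WithTop ℕ∞) ψ → HasCompactSupport ψ → tsupport ψ ⊆ Ω → ∀ i j : Fin 3,
    ∫ x in Ω, fderiv ℝ ψ x (EuclideanSpace.single j 1) * u x i =
      - ∫ x in Ω, ψ x * J x (i, j)

lemma integrable_test {m : Type*} [Fintype m] {p : ℝ} [Fact (1 < p)] {Ω : Set E3}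
    (u : Lp (EuclideanSpace ℝ m) (ENNReal.ofReal p) (vol Ω)) {g : E3 → ℝ} (hg : Continuous g)
    (hc : HasCompactSupport g) (i : m) : Integrable (fun x => g x * u x i) (vol Ω) := by
  have h1 : LocallyIntegrable u (vol Ω) :=
    (Lp.memLp u).locallyIntegrable (fact_one_le_ofReal p).out
  have h2 := h1.integrable_smul_left_of_hasCompactSupport hg hc
  have h3 := (EuclideanSpace.proj (𝕜 := ℝ) i).integrable_comp h2
  simpa using h3

/-- `W^{1,p}(Ω)³`; an element is the pair of a field in `L^p` and its (unique) weak gradient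
in `L^p`. -/
def W1p (p : ℝ) [Fact (1 < p)] (Ω : Set E3) : Submodule ℝ (LpVec p Ω × LpMat p Ω) where
  carrier := {φ | IsWeakGradient Ω φ.1 φ.2}
  zero_mem' := by
    intro ψ _ _ _ i j
    have h1 := Lp.coeFn_zero E3 (ENNReal.ofReal p) (vol Ω)
    have h2 := Lp.coeFn_zero Mat3 (ENNReal.ofReal p) (vol Ω)
    rw [integral_eq_zero_of_ae, integral_eq_zero_of_ae]
    · simp
    · filter_upwards [h2] with x hx
      rw [Prod.snd_zero, hx]; simp
    · filter_upwards [h1] with x hx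
      rw [Prod.fst_zero, hx]; simp
  add_mem' := by
    intro a b ha hb ψ h1 h2 h3 i j
    have hd : Continuous fun x => fderiv ℝ ψ x (EuclideanSpace.single j 1) :=
      (h1.continuous_fderiv (by simp)).clm_apply continuous_const
    have hdc : HasCompactSupport fun x => fderiv ℝ ψ x (EuclideanSpace.single j 1) :=
      h2.fderiv_apply (𝕜 := ℝ) _
    have e1 : ∀ᵐ x ∂vol Ω, fderiv ℝ ψ x (EuclideanSpace.single j 1) * (a + b).1 x i =
        fderiv ℝ ψ x (EuclideanSpace.single j 1) * a.1 x i +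
        fderiv ℝ ψ x (EuclideanSpace.single j 1) * b.1 x i := by
      filter_upwards [Lp.coeFn_add a.1 b.1] with x hx
      rw [Prod.fst_add, hx]; simp [mul_add]
    have e2 : ∀ᵐ x ∂vol Ω, ψ x * (a + b).2 x (i, j) =
        ψ x * a.2 x (i, j) + ψ x * b.2 x (i, j) := by
      filter_upwards [Lp.coeFn_add a.2 b.2] with x hx
      rw [Prod.snd_add, hx]; simp [mul_add]
    rw [integral_congr_ae e1, integral_congr_ae e2,
      integral_add (integrable_test a.1 hd hdc i) (integrable_test b.1 hd hdc i),
      integral_add (integrable_test a.2 h1.continuous h2 (i, j))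
        (integrable_test b.2 h1.continuous h2 (i, j)), ha ψ h1 h2 h3 i j, hb ψ h1 h2 h3 i j]
    ring
  smul_mem' := by
    intro c a ha ψ h1 h2 h3 i j
    have e1 : ∀ᵐ x ∂vol Ω, fderiv ℝ ψ x (EuclideanSpace.single j 1) * (c • a).1 x i =
        c * (fderiv ℝ ψ x (EuclideanSpace.single j 1) * a.1 x i) := by
      filter_upwards [Lp.coeFn_smul c a.1] with x hx
      rw [Prod.smul_fst, hx]; simp; ring
    have e2 : ∀ᵐ x ∂vol Ω, ψ x * (c • a).2 x (i, j) = c * (ψ x * a.2 x (i, j)) := by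
      filter_upwards [Lp.coeFn_smul c a.2] with x hx
      rw [Prod.smul_snd, hx]; simp; ring
    rw [integral_congr_ae e1, integral_congr_ae e2, integral_const_mul, integral_const_mul,
      ha ψ h1 h2 h3 i j]
    ring

/-- The field underlying an element of `W^{1,p}`. -/
def fld {p : ℝ} [Fact (1 < p)] {Ω : Set E3} : W1p p Ω →ₗ[ℝ] LpVec p Ω :=
  (LinearMap.fst ℝ (LpVec p Ω) (LpMat p Ω)).comp (W1p p Ω).subtype

/-- The weak gradient of an element of `W^{1,p}`. -/
def grad {p : ℝ} [Fact (1 < p)] {Ω : Set E3} : W1p p Ω →ₗ[ℝ] LpMat p Ω :=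
  (LinearMap.snd ℝ (LpVec p Ω) (LpMat p Ω)).comp (W1p p Ω).subtype

/-- The graph of the restriction map `ψ ↦ ψ|_∂Ω` on smooth fields up to the boundary: the triples
(`ψ` on `Ω`, `∇ψ` on `Ω`, `ψ` on `∂Ω`) with `ψ` in `C^∞(ℝ³)³`. -/
def smoothTraceGraph (p : ℝ) [Fact (1 < p)] (Ω : Set E3) :
    Submodule ℝ (LpVec p Ω × LpMat p Ω × LpBdry p Ω) where
  carrier := {t | ∃ ψ : E3 → E3, ContDiff ℝ ((⊤ : ℕ∞) : WithTop ℕ∞) ψ ∧ t.1 =ᵐ[vol Ω] ψ ∧ t.2.1 =ᵐ[vol Ω] jac ψ ∧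
    t.2.2 =ᵐ[surf Ω] ψ}
  zero_mem' := by
    refine ⟨0, contDiff_zero_fun, Lp.coeFn_zero _ _ _, ?_, Lp.coeFn_zero _ _ _⟩
    filter_upwards [Lp.coeFn_zero Mat3 (ENNReal.ofReal p) (vol Ω)] with x hx
    rw [Prod.snd_zero, Prod.fst_zero, hx]
    ext ij
    simp [jac]
  add_mem' := by
    rintro a b ⟨ψ, h, h1, h2, h3⟩ ⟨χ, k, k1, k2, k3⟩
    refine ⟨ψ + χ, h.add k, (Lp.coeFn_add a.1 b.1).trans (h1.add k1), ?_,
      (Lp.coeFn_add a.2.2 b.2.2).trans (h3.add k3)⟩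
    filter_upwards [Lp.coeFn_add a.2.1 b.2.1, h2, k2] with x hx hx1 hx2
    rw [Prod.snd_add, Prod.fst_add, hx, Pi.add_apply, hx1, hx2]
    ext ij
    simp [jac, fderiv_add (h.differentiable (by simp) x) (k.differentiable (by simp) x)]
  smul_mem' := by
    rintro c a ⟨ψ, h, h1, h2, h3⟩
    refine ⟨c • ψ, contDiff_const.smul h, ?_, ?_, ?_⟩
    · filter_upwards [Lp.coeFn_smul c a.1, h1] with x hx hx1
      rw [Prod.smul_fst, hx, Pi.smul_apply, hx1, Pi.smul_apply]
    · filter_upwards [Lp.coeFn_smul c a.2.1, h2] with x hx hx1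
      rw [Prod.smul_snd, Prod.smul_fst, hx, Pi.smul_apply, hx1]
      ext ij
      simp [jac, fderiv_const_smul (h.differentiable (by simp) x) c]
    · filter_upwards [Lp.coeFn_smul c a.2.2, h3] with x hx hx1
      rw [Prod.smul_snd, Prod.smul_snd, hx, Pi.smul_apply, hx1, Pi.smul_apply]

/-- `τ` is the trace of `φ` on `∂Ω`. The trace operator `W^{1,p}(Ω)³ → L^p(∂Ω)³` is the continuous
extension of the restriction map, so its graph is the closure of the graph of that map. -/
def HasTrace {p : ℝ} [Fact (1 < p)] {Ω : Set E3} (φ : W1p p Ω) (τ : LpBdry p Ω) : Prop :=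
  (fld φ, grad φ, τ) ∈ (smoothTraceGraph p Ω).topologicalClosure

/-- `φ = 0` on the part `Γ` of `∂Ω`, in the sense of traces. -/
def VanishesOn {p : ℝ} [Fact (1 < p)] {Ω : Set E3} (Γ : Set E3) (φ : W1p p Ω) : Prop :=
  ∃ τ, HasTrace φ τ ∧ ∀ᵐ x ∂surf Ω, x ∈ Γ → τ x = 0

/-- `φ · n = 0` on the part `Γ` of `∂Ω` (on which `n` is constant), in the sense of traces. -/
def NormalVanishesOn {p : ℝ} [Fact (1 < p)] {Ω : Set E3} (Γ : Set E3) (n : E3) (φ : W1p p Ω) :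
    Prop :=
  ∃ τ, HasTrace φ τ ∧ ∀ᵐ x ∂surf Ω, x ∈ Γ → inner ℝ (τ x) n = 0

/-- `div φ = 0` in `Ω`. -/
def DivFree {p : ℝ} [Fact (1 < p)] {Ω : Set E3} (φ : W1p p Ω) : Prop :=
  ∀ᵐ x ∂vol Ω, ∑ i : Fin 3, grad φ x (i, i) = 0

section closure

variable {p : ℝ} [Fact (1 < p)] {Ω : Set E3}

lemma HasTrace.zero : HasTrace (0 : W1p p Ω) 0 := by
  exact (smoothTraceGraph p Ω).topologicalClosure.zero_mem

lemma HasTrace.add {φ χ : W1p p Ω} {τ σ : LpBdry p Ω} (h : HasTrace φ τ) (k : HasTrace χ σ) :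
    HasTrace (φ + χ) (τ + σ) := by
  simpa [HasTrace] using (smoothTraceGraph p Ω).topologicalClosure.add_mem h k

lemma HasTrace.smul {φ : W1p p Ω} {τ : LpBdry p Ω} (c : ℝ) (h : HasTrace φ τ) :
    HasTrace (c • φ) (c • τ) := by
  simpa [HasTrace] using (smoothTraceGraph p Ω).topologicalClosure.smul_mem c h

end closure

/-- `W^{1,p}_Γ(Ω)³`, the fields that vanish on `Γ`. -/
def W1pVanishing (p : ℝ) [Fact (1 < p)] (Ω Γ : Set E3) : Submodule ℝ (W1p p Ω) where
  carrier := {φ | VanishesOn Γ φ}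
  zero_mem' := ⟨0, HasTrace.zero, by
    filter_upwards [Lp.coeFn_zero E3 (ENNReal.ofReal p) (surf Ω)] with x hx _
    rw [hx]; simp⟩
  add_mem' := by
    rintro a b ⟨τ, h, h'⟩ ⟨σ, k, k'⟩
    refine ⟨τ + σ, h.add k, ?_⟩
    filter_upwards [h', k', Lp.coeFn_add τ σ] with x h1 h2 h3 hx
    rw [h3, Pi.add_apply, h1 hx, h2 hx, add_zero]
  smul_mem' := by
    rintro c a ⟨τ, h, h'⟩
    refine ⟨c • τ, h.smul c, ?_⟩
    filter_upwards [h', Lp.coeFn_smul c τ] with x h1 h3 hx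
    rw [h3, Pi.smul_apply, h1 hx, smul_zero]

/-- The fields in `W^{1,p}(Ω)³` with `φ · n = 0` on `Γ`. -/
def W1pTangential (p : ℝ) [Fact (1 < p)] (Ω Γ : Set E3) (n : E3) : Submodule ℝ (W1p p Ω) where
  carrier := {φ | NormalVanishesOn Γ n φ}
  zero_mem' := ⟨0, HasTrace.zero, by
    filter_upwards [Lp.coeFn_zero E3 (ENNReal.ofReal p) (surf Ω)] with x hx _
    rw [hx]; simp⟩
  add_mem' := by
    rintro a b ⟨τ, h, h'⟩ ⟨σ, k, k'⟩
    refine ⟨τ + σ, h.add k, ?_⟩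
    filter_upwards [h', k', Lp.coeFn_add τ σ] with x h1 h2 h3 hx
    rw [h3, Pi.add_apply, inner_add_left, h1 hx, h2 hx, add_zero]
  smul_mem' := by
    rintro c a ⟨τ, h, h'⟩
    refine ⟨c • τ, h.smul c, ?_⟩
    filter_upwards [h', Lp.coeFn_smul c τ] with x h1 h3 hx
    rw [h3, Pi.smul_apply, inner_smul_left, h1 hx, mul_zero]

/-- The divergence-free fields in `W^{1,p}(Ω)³`. -/
def W1pDivFree (p : ℝ) [Fact (1 < p)] (Ω : Set E3) : Submodule ℝ (W1p p Ω) where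
  carrier := {φ | DivFree φ}
  zero_mem' := by
    filter_upwards [Lp.coeFn_zero Mat3 (ENNReal.ofReal p) (vol Ω)] with x hx
    rw [map_zero, hx]; simp
  add_mem' := by
    intro a b ha hb
    filter_upwards [ha, hb, Lp.coeFn_add (grad a) (grad b)] with x h1 h2 h3
    rw [map_add, h3]
    simp [Finset.sum_add_distrib, h1, h2]
  smul_mem' := by
    intro c a ha
    filter_upwards [ha, Lp.coeFn_smul c (grad a)] with x h1 h3
    rw [map_smul, h3]
    simp [← Finset.mul_sum, h1]

/-- `V_0^p`. -/
def V0Sub (p : ℝ) [Fact (1 < p)] (U : Set E2) (h : E2 → ℝ) : Submodule ℝ (W1p p (dom U h)) :=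
  W1pVanishing p (dom U h) (top U h ∪ lateral U h) ⊓
    W1pTangential p (dom U h) (bottom U h) bottomNormal

/-- `V_{0.div}^p` as a subspace of `W^{1,p}(Ω)³`. -/
def V0divSub (p : ℝ) [Fact (1 < p)] (U : Set E2) (h : E2 → ℝ) : Submodule ℝ (W1p p (dom U h)) :=
  V0Sub p U h ⊓ W1pDivFree p (dom U h)

/-- `V_{0.div}^p`, a type of its own, since its norm is not the one inherited from `W^{1,p}`. -/
def V0div (p : ℝ) [Fact (1 < p)] (U : Set E2) (h : E2 → ℝ) : Type := ↥(V0divSub p U h)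

section V0div

variable {p : ℝ} [Fact (1 < p)] {U : Set E2} {h : E2 → ℝ}

instance : AddCommGroup (V0div p U h) := inferInstanceAs (AddCommGroup ↥(V0divSub p U h))

instance : Module ℝ (V0div p U h) := inferInstanceAs (Module ℝ ↥(V0divSub p U h))

/-- The inclusion of `V_{0.div}^p` in `W^{1,p}(Ω)³`. -/
def toW1p : V0div p U h →ₗ[ℝ] W1p p (dom U h) := (V0divSub p U h).subtype

/-- The norm `‖φ‖_{1.p} = (∫_Ω |∇φ|^p)^{1/p}` of `V_{0.div}^p`. (Only the seminorm axioms are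
recorded; definiteness is Poincaré's inequality for fields that vanish on `Γ₁`.) -/
instance : SeminormedAddCommGroup (V0div p U h) :=
  SeminormedAddCommGroup.induced (V0div p U h) (LpMat p (dom U h))
    (grad.comp (toW1p (p := p) (U := U) (h := h)))

instance : NormedSpace ℝ (V0div p U h) :=
  NormedSpace.induced ℝ (V0div p U h) (LpMat p (dom U h))
    (grad.comp (toW1p (p := p) (U := U) (h := h)))

end V0div

/-! ### The operator -/

/-- The strain rate tensor `D(u) = (∇u + ∇uᵀ) / 2` as a function of the gradient `J = ∇u`. -/
def strain (J : Mat3) : Mat3 := WithLp.toLp 2 fun ij => (J (ij.1, ij.2) + J (ij.2, ij.1)) / 2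

/-- `ℱ(λ₀, λ₁, λ₂) = 2 μ(λ₀, λ₁, |λ₂|) |λ₂|^(p-2) λ₂` if `λ₂ ≠ 0`, and `0` otherwise. -/
def stress (μ : ℝ → E3 → ℝ≥0 → ℝ) (p : ℝ) (l₀ : ℝ) (l₁ : E3) (l₂ : Mat3) : Mat3 :=
  open Classical in
  if l₂ ≠ 0 then (2 * μ l₀ l₁ ‖l₂‖₊ * ‖l₂‖ ^ (p - 2)) • l₂ else 0

/-- The integrand `ℱ(θ, υ + G, D(w + G)) : D(φ)` of `⟨A_{θ,υ} w, φ⟩`. -/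
def flowIntegrand {p : ℝ} [Fact (1 < p)] {U : Set E2} {h : E2 → ℝ} (μ : ℝ → E3 → ℝ≥0 → ℝ)
    (θ : E3 → ℝ) (υ : LpVec p (dom U h)) (G : W1p p (dom U h)) (w φ : V0div p U h) (x : E3) : ℝ :=
  inner ℝ (stress μ p (θ x) ((υ + fld G) x) (strain (grad (toW1p w + G) x)))
    (strain (grad (toW1p φ) x))

/-- A (nonlinear) operator is bounded if it maps bounded sets to bounded sets. -/
def IsBoundedOperator {V : Type*} [SeminormedAddCommGroup V] [NormedSpace ℝ V]
    (A : V → StrongDual ℝ V) : Prop :=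
  ∀ S : Set V, Bornology.IsBounded S → Bornology.IsBounded (A '' S)

/-- `A` is pseudo-monotone: if `u_n ⇀ u` weakly and `limsup ⟨A u_n, u_n - u⟩ ≤ 0`, then
`⟨A u, u - v⟩ ≤ liminf ⟨A u_n, u_n - v⟩` for all `v`. -/
def IsPseudoMonotone {V : Type*} [SeminormedAddCommGroup V] [NormedSpace ℝ V]
    (A : V → StrongDual ℝ V) : Prop :=
  ∀ (u : ℕ → V) (u₀ : V), (∀ l : StrongDual ℝ V, Tendsto (fun n => l (u n)) atTop (𝓝 (l u₀))) →
    limsup (fun n => ((A (u n) (u n - u₀) : ℝ) : EReal)) atTop ≤ 0 →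
    ∀ v : V, ((A u₀ (u₀ - v) : ℝ) : EReal) ≤
      liminf (fun n => ((A (u n) (u n - v) : ℝ) : EReal)) atTop

end

end FluidFlow

namespace FluidFlow

/-! With `θ` and `υ` frozen, the unknown enters only through `D(w + G)`. Hence `A w = N (S w + D(G))
∘ S`, where `S` is the symmetric gradient `V → L^p` and `N` is the superposition operator of the
stress from `L^p` to its dual; everything reduces to properties of `N`.

The stress is a radial field whose magnitude `2 μ(o, e, d) d^(p-1)` is nondecreasing in `d`, so it
is monotone (`stress_monotone`), and so is `N`. Its growth is at most `2 μ₁ d^(p-1)`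
(`norm_stress_le`): Hölder then bounds `N` (`exists_stressOp`), and dominated convergence makes `N`
continuous along lines (`tendsto_integral_stress`). Minty's argument turns these two properties into
pseudo-monotonicity (`isPseudoMonotone_of_monotone`), without compactness. -/

/-! ### Monotone hemicontinuous operators -/

/-- A monotone operator that is continuous along line segments is pseudo-monotone. -/
theorem isPseudoMonotone_of_monotone {V : Type*} [SeminormedAddCommGroup V] [NormedSpace ℝ V]
    {A : V → StrongDual ℝ V} (hmono : ∀ u v, 0 ≤ A u (u - v) - A v (u - v))
    (hcont : ∀ u v φ, Tendsto (fun t : ℝ => A (u + t • v) φ) (𝓝[>] 0) (𝓝 (A u φ))) :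
    IsPseudoMonotone A := by
  intro u u₀ hu hlim v
  have hdiff : ∀ l : StrongDual ℝ V, Tendsto (fun n => l (u n - u₀)) atTop (𝓝 0) := by
    intro l
    simpa using (hu l).sub_const (l u₀)
  have hupper : ∀ ε : ℝ, 0 < ε → ∀ᶠ n in atTop, A (u n) (u n - u₀) < ε := by
    intro ε hε
    have h0 : limsup (fun n => ((A (u n) (u n - u₀) : ℝ) : EReal)) atTop < (ε : EReal) :=
      hlim.trans_lt (by exact_mod_cast hε)
    filter_upwards [eventually_lt_of_limsup_lt h0] with n hn
    exact_mod_cast hn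
  -- Monotonicity gives `A (u n) (u n - u₀) ≥ A u₀ (u n - u₀)`, and the right side tends to `0` by
  -- weak convergence.
  have hlower : ∀ ε : ℝ, 0 < ε → ∀ᶠ n in atTop, -ε < A (u n) (u n - u₀) := by
    intro ε hε
    filter_upwards [(hdiff (A u₀)).eventually_const_lt (neg_neg_of_pos hε)] with n hn
    linarith [hmono (u n) u₀]
  refine EReal.ge_of_forall_gt_iff_ge.1 fun c hc => ?_
  have hc' : c < A u₀ (u₀ - v) := by exact_mod_cast hc
  -- The gap above `c` absorbs four errors of size `δ`: one from hemicontinuity, two from comparing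
  -- `u n` with `w`, one from `hlower`.
  set δ := (A u₀ (u₀ - v) - c) / 4 with hδ
  have hδ0 : 0 < δ := by rw [hδ]; linarith
  have hev : ∀ᶠ t : ℝ in 𝓝[>] 0, A u₀ (u₀ - v) - δ < A (u₀ + t • (v - u₀)) (u₀ - v) :=
    (hcont u₀ (v - u₀) (u₀ - v)).eventually_const_lt (by linarith)
  obtain ⟨t, hAt, ht : 0 < t⟩ := (hev.and self_mem_nhdsWithin).exists
  set w := u₀ + t • (v - u₀) with hw
  refine le_liminf_of_le isCobounded_ge_of_top ?_
  -- Two of the errors must be `t * δ` because the monotonicity inequality is divided by `t` below;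
  -- `t` is fixed before `n` grows.
  have htδ : 0 < t * δ := mul_pos ht hδ0
  filter_upwards [hupper _ htδ, hlower _ hδ0,
    (hdiff (A w)).eventually_const_lt (neg_neg_of_pos htδ)] with n h1 h2 h3
  have hm := hmono (u n) w
  have e1 : u n - w = (u n - u₀) + t • (u₀ - v) := by rw [hw]; module
  have e2 : u n - v = (u n - u₀) + (u₀ - v) := by abel
  simp only [e1, map_add, map_smul, smul_eq_mul] at hm
  have h4 : t * (A w (u₀ - v) - 2 * δ) < t * A (u n) (u₀ - v) := by
    nlinarith
  have h5 := lt_of_mul_lt_mul_left h4 ht.le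
  rw [e2, map_add]
  have : c ≤ A (u n) (u n - u₀) + A (u n) (u₀ - v) := by
    have : A u₀ (u₀ - v) = c + 4 * δ := by rw [hδ]; ring
    linarith
  exact_mod_cast this

/-! ### The stress tensor -/

section stress

variable {μ : ℝ → E3 → ℝ≥0 → ℝ} {p : ℝ}

/-- The case split is redundant: at `l = 0` the vector factor vanishes, whatever value `0 ^ (p - 2)`
takes. -/
lemma stress_eq (o : ℝ) (e : E3) (l : Mat3) :
    stress μ p o e l = (2 * μ o e ‖l‖₊ * ‖l‖ ^ (p - 2)) • l := by
  unfold stress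
  split_ifs with hl
  · rfl
  · simp [not_not.1 hl]

lemma rpow_sub_two_mul_self {p : ℝ} (hp : 1 < p) {s : ℝ} (hs : 0 ≤ s) :
    s ^ (p - 2) * s = s ^ (p - 1) := by
  rcases hs.eq_or_lt with rfl | hs
  · rw [mul_zero, Real.zero_rpow (by linarith)]
  · rw [← Real.rpow_add_one hs.ne']; congr 1; ring

lemma norm_stress_le (hp : 1 < p) {μ₁ : ℝ} (hμ : ∀ o e d, 0 ≤ μ o e d ∧ μ o e d ≤ μ₁)
    (o : ℝ) (e : E3) (l : Mat3) : ‖stress μ p o e l‖ ≤ 2 * μ₁ * ‖l‖ ^ (p - 1) := by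
  have h0 := (hμ o e ‖l‖₊).1
  rw [stress_eq, norm_smul, Real.norm_of_nonneg (by positivity), mul_assoc,
    rpow_sub_two_mul_self hp (norm_nonneg l)]
  gcongr
  exact (hμ o e _).2

/-- Only the origin is delicate, since `‖l‖ ^ (p - 2)` is singular there for `p < 2`; the growth
bound squeezes the stress to `0`. -/
lemma continuous_stress (hp : 1 < p) {μ₁ : ℝ} (hμ : ∀ o e d, 0 ≤ μ o e d ∧ μ o e d ≤ μ₁)
    {o : ℝ} {e : E3} (hc : Continuous (μ o e)) : Continuous (stress μ p o e) := by
  rw [continuous_iff_continuousAt]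
  intro l
  by_cases hl : l = 0
  · subst hl
    have h0 : stress μ p o e 0 = 0 := by simp [stress_eq]
    rw [ContinuousAt, h0]
    refine squeeze_zero_norm (norm_stress_le hp hμ o e) ?_
    have hlim : Continuous fun l : Mat3 => 2 * μ₁ * ‖l‖ ^ (p - 1) :=
      continuous_const.mul (continuous_norm.rpow_const fun _ => Or.inr (by linarith))
    simpa [Real.zero_rpow (sub_pos.2 hp).ne'] using hlim.tendsto 0
  · have h1 : stress μ p o e = fun l => (2 * μ o e ‖l‖₊ * ‖l‖ ^ (p - 2)) • l :=
      funext (stress_eq o e)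
    rw [h1]
    refine ContinuousAt.smul (f := fun l : Mat3 => 2 * μ o e ‖l‖₊ * ‖l‖ ^ (p - 2)) (g := id)
      (ContinuousAt.mul ?_ ?_) continuousAt_id
    · exact (continuous_const.mul (hc.comp continuous_nnnorm)).continuousAt
    · exact continuous_norm.continuousAt.rpow_const (Or.inl (norm_ne_zero_iff.2 hl))

lemma stress_monotone (hp : 1 < p) (hμ : ∀ o e d, 0 ≤ μ o e d) {o : ℝ} {e : E3}
    (hm : Monotone (μ o e)) (a b : Mat3) :
    0 ≤ inner ℝ (stress μ p o e a - stress μ p o e b) (a - b) := by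
  -- The radial profile is a product of nonnegative nondecreasing functions of the norm.
  have key : ∀ a b : Mat3, ‖a‖ ≤ ‖b‖ →
      2 * μ o e ‖a‖₊ * ‖a‖ ^ (p - 2) * ‖a‖ ≤ 2 * μ o e ‖b‖₊ * ‖b‖ ^ (p - 2) * ‖b‖ := by
    intro a b hab
    rw [mul_assoc _ _ ‖a‖, mul_assoc _ _ ‖b‖, rpow_sub_two_mul_self hp (norm_nonneg a),
      rpow_sub_two_mul_self hp (norm_nonneg b)]
    have := hm (show ‖a‖₊ ≤ ‖b‖₊ from hab)
    have := hμ o e ‖b‖₊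
    gcongr
  rw [stress_eq, stress_eq]
  have ha : 0 ≤ 2 * μ o e ‖a‖₊ * ‖a‖ ^ (p - 2) := by have := hμ o e ‖a‖₊; positivity
  have hb : 0 ≤ 2 * μ o e ‖b‖₊ * ‖b‖ ^ (p - 2) := by have := hμ o e ‖b‖₊; positivity
  have hab := key a b
  have hba := key b a
  generalize 2 * μ o e ‖a‖₊ * ‖a‖ ^ (p - 2) = s at *
  generalize 2 * μ o e ‖b‖₊ * ‖b‖ ^ (p - 2) = r at *
  simp only [inner_sub_left, inner_sub_right, real_inner_smul_left, real_inner_self_eq_norm_sq,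
    real_inner_comm a b]
  have hcs := mul_le_mul_of_nonneg_left (real_inner_le_norm a b) (add_nonneg ha hb)
  -- By Cauchy–Schwarz, `⟨s a - r b, a - b⟩` is at least this product, whose factors have the same
  -- sign by `key`.
  have : 0 ≤ (s * ‖a‖ - r * ‖b‖) * (‖a‖ - ‖b‖) := by
    rcases le_total ‖a‖ ‖b‖ with h | h
    · exact mul_nonneg_of_nonpos_of_nonpos (by linarith [hab h]) (by linarith)
    · exact mul_nonneg (by linarith [hba h]) (by linarith)
  linarith

end stress

/-! ### The stress operator on `L^p` -/

section Lp

variable {α E F : Type*} [MeasurableSpace α] {ν : Measure α} [NormedAddCommGroup E]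
  [NormedAddCommGroup F] {p : ℝ}

/-- The conjugate exponent is `p / (p - 1)`, so the power `p - 1` carries `L^p` exactly into the
dual exponent. -/
lemma memLp_norm_rpow_sub_one (hp : 1 < p) {f : α → E} (hf : MemLp f (ENNReal.ofReal p) ν) :
    MemLp (fun x => ‖f x‖ ^ (p - 1)) (ENNReal.ofReal p.conjExponent) ν := by
  have h1 := hf.norm_rpow_div (ENNReal.ofReal (p - 1))
  rwa [ENNReal.toReal_ofReal (by linarith), ← ENNReal.ofReal_div_of_pos (by linarith)] at h1

lemma integrable_norm_rpow_mul_norm (hp : 1 < p) {f : α → E} {g : α → F}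
    (hf : MemLp f (ENNReal.ofReal p) ν) (hg : MemLp g (ENNReal.ofReal p) ν) :
    Integrable (fun x => ‖f x‖ ^ (p - 1) * ‖g x‖) ν := by
  have := (Real.HolderConjugate.conjExponent hp).symm.ennrealOfReal
  exact (memLp_norm_rpow_sub_one hp hf).integrable_mul hg.norm

lemma Lp_norm_eq (hp : 1 < p) (f : Lp E (ENNReal.ofReal p) ν) :
    ‖f‖ = (∫ x, ‖f x‖ ^ p ∂ν) ^ (1 / p) := by
  rw [Lp.norm_def, (Lp.memLp f).eLpNorm_eq_integral_rpow_norm (by simp; linarith) (by simp),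
    ENNReal.toReal_ofReal (by positivity), ENNReal.toReal_ofReal (by linarith), one_div]

/-- Hölder's inequality for `|f|^(p-1) |g|`. -/
lemma integral_norm_rpow_mul_norm_le (hp : 1 < p) (f : Lp E (ENNReal.ofReal p) ν)
    (g : Lp F (ENNReal.ofReal p) ν) :
    ∫ x, ‖f x‖ ^ (p - 1) * ‖g x‖ ∂ν ≤ ‖f‖ ^ (p - 1) * ‖g‖ := by
  have hpq := (Real.HolderConjugate.conjExponent hp).symm
  refine (integral_mul_le_Lp_mul_Lq_of_nonneg hpq (ae_of_all _ fun x => by positivity)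
    (ae_of_all _ fun x => by positivity) (memLp_norm_rpow_sub_one hp (Lp.memLp f))
    (Lp.memLp g).norm).trans_eq ?_
  have hp1 : p - 1 ≠ 0 := by linarith
  have hp0 : p ≠ 0 := by linarith
  have h0 : 0 ≤ ∫ x, ‖f x‖ ^ p ∂ν := by positivity
  have h1 : ∀ x, (‖f x‖ ^ (p - 1)) ^ p.conjExponent = ‖f x‖ ^ p := fun x => by
    rw [← Real.rpow_mul (norm_nonneg _)]
    congr 1
    unfold Real.conjExponent
    field_simp
  simp only [h1]
  rw [Lp_norm_eq hp f, Lp_norm_eq hp g, ← Real.rpow_mul h0]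
  congr 2
  unfold Real.conjExponent
  field_simp

end Lp

section stressOp

variable {α : Type*} [MeasurableSpace α] {ν : Measure α} {p : ℝ} {μ : ℝ → E3 → ℝ≥0 → ℝ} {μ₁ : ℝ}
  {o : α → ℝ} {e : α → E3}

lemma aestronglyMeasurable_stress
    (hc : Continuous fun z : ℝ × E3 × ℝ≥0 => μ z.1 z.2.1 z.2.2)
    (ho : AEStronglyMeasurable o ν) (he : AEStronglyMeasurable e ν) {ξ : α → Mat3}
    (hξ : AEStronglyMeasurable ξ ν) :
    AEStronglyMeasurable (fun x => stress μ p (o x) (e x) (ξ x)) ν := by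
  simp only [stress_eq]
  have h1 : AEStronglyMeasurable (fun x => 2 * μ (o x) (e x) ‖ξ x‖₊) ν :=
    (hc.comp_aestronglyMeasurable
      (ho.prodMk (he.prodMk (continuous_nnnorm.comp_aestronglyMeasurable hξ)))).const_mul 2
  -- For `p < 2` the power is discontinuous at `0`, so its measurability is used instead of
  -- continuity.
  exact (h1.mul (hξ.norm.aemeasurable.pow_const _).aestronglyMeasurable).smul hξ

lemma norm_inner_stress_le (hp : 1 < p) (hμ : ∀ o e d, 0 ≤ μ o e d ∧ μ o e d ≤ μ₁) (a : ℝ) (b : E3)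
    (l m : Mat3) : ‖inner ℝ (stress μ p a b l) m‖ ≤ 2 * μ₁ * (‖l‖ ^ (p - 1) * ‖m‖) := by
  refine (norm_inner_le_norm _ _).trans ?_
  rw [← mul_assoc]
  gcongr
  exact norm_stress_le hp hμ a b l

lemma integrable_inner_stress (hp : 1 < p)
    (hc : Continuous fun z : ℝ × E3 × ℝ≥0 => μ z.1 z.2.1 z.2.2)
    (hμ : ∀ o e d, 0 ≤ μ o e d ∧ μ o e d ≤ μ₁)
    (ho : AEStronglyMeasurable o ν) (he : AEStronglyMeasurable e ν) {ξ η : α → Mat3}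
    (hξ : MemLp ξ (ENNReal.ofReal p) ν) (hη : MemLp η (ENNReal.ofReal p) ν) :
    Integrable (fun x => inner ℝ (stress μ p (o x) (e x) (ξ x)) (η x)) ν :=
  ((integrable_norm_rpow_mul_norm hp hξ hη).const_mul (2 * μ₁)).mono'
    ((aestronglyMeasurable_stress hc ho he hξ.1).inner hη.1)
    (ae_of_all _ fun _ => norm_inner_stress_le hp hμ _ _ _ _)

/-- The operator `ξ ↦ (η ↦ ∫ ℱ(o, e, ξ) : η)` from `L^p` to its dual. -/
theorem exists_stressOp [Fact (1 < p)]
    (hc : Continuous fun z : ℝ × E3 × ℝ≥0 => μ z.1 z.2.1 z.2.2)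
    (hμ : ∀ o e d, 0 ≤ μ o e d ∧ μ o e d ≤ μ₁)
    (ho : AEStronglyMeasurable o ν) (he : AEStronglyMeasurable e ν) :
    ∃ N : Lp Mat3 (ENNReal.ofReal p) ν → StrongDual ℝ (Lp Mat3 (ENNReal.ofReal p) ν),
      (∀ ξ η, N ξ η = ∫ x, inner ℝ (stress μ p (o x) (e x) (ξ x)) (η x) ∂ν) ∧
      ∀ ξ, ‖N ξ‖ ≤ 2 * μ₁ * ‖ξ‖ ^ (p - 1) := by
  have hp : 1 < p := Fact.out
  have hμ₁ : 0 ≤ μ₁ := (hμ 0 0 0).1.trans (hμ 0 0 0).2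
  have hint (ξ η : Lp Mat3 (ENNReal.ofReal p) ν) :=
    integrable_inner_stress hp hc hμ ho he (Lp.memLp ξ) (Lp.memLp η)
  let B (ξ : Lp Mat3 (ENNReal.ofReal p) ν) : Lp Mat3 (ENNReal.ofReal p) ν →ₗ[ℝ] ℝ :=
    { toFun := fun η => ∫ x, inner ℝ (stress μ p (o x) (e x) (ξ x)) (η x) ∂ν
      map_add' := fun η ζ => by
        rw [← integral_add (hint ξ η) (hint ξ ζ)]
        refine integral_congr_ae ?_
        filter_upwards [Lp.coeFn_add η ζ] with x hx
        rw [hx, Pi.add_apply, inner_add_right]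
      map_smul' := fun c η => by
        rw [RingHom.id_apply, smul_eq_mul, ← integral_const_mul]
        refine integral_congr_ae ?_
        filter_upwards [Lp.coeFn_smul c η] with x hx
        rw [hx, Pi.smul_apply, real_inner_smul_right] }
  have hB : ∀ ξ η, ‖B ξ η‖ ≤ 2 * μ₁ * ‖ξ‖ ^ (p - 1) * ‖η‖ := fun ξ η => by
    refine (norm_integral_le_of_norm_le
      ((integrable_norm_rpow_mul_norm hp (Lp.memLp ξ) (Lp.memLp η)).const_mul (2 * μ₁))
      (ae_of_all _ fun x => norm_inner_stress_le hp hμ _ _ _ _)).trans ?_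
    rw [integral_const_mul, mul_assoc (2 * μ₁)]
    gcongr
    exact integral_norm_rpow_mul_norm_le hp ξ η
  exact ⟨fun ξ => (B ξ).mkContinuous _ (hB ξ), fun _ _ => rfl,
    fun ξ => LinearMap.mkContinuous_norm_le _ (by positivity) _⟩

lemma integral_stress_monotone (hp : 1 < p)
    (hc : Continuous fun z : ℝ × E3 × ℝ≥0 => μ z.1 z.2.1 z.2.2)
    (hμ : ∀ o e d, 0 ≤ μ o e d ∧ μ o e d ≤ μ₁) (hm : ∀ o e, Monotone (μ o e))
    (ho : AEStronglyMeasurable o ν) (he : AEStronglyMeasurable e ν)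
    (ξ η : Lp Mat3 (ENNReal.ofReal p) ν) :
    0 ≤ ∫ x, inner ℝ (stress μ p (o x) (e x) (ξ x)) ((ξ - η : Lp Mat3 (ENNReal.ofReal p) ν) x) ∂ν -
      ∫ x, inner ℝ (stress μ p (o x) (e x) (η x)) ((ξ - η : Lp Mat3 (ENNReal.ofReal p) ν) x) ∂ν := by
  rw [← integral_sub (integrable_inner_stress hp hc hμ ho he (Lp.memLp ξ) (Lp.memLp _))
    (integrable_inner_stress hp hc hμ ho he (Lp.memLp η) (Lp.memLp _))]
  refine integral_nonneg_of_ae ?_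
  filter_upwards [Lp.coeFn_sub ξ η] with x hx
  rw [hx, Pi.sub_apply, ← inner_sub_left]
  exact stress_monotone hp (fun o e d => (hμ o e d).1) (hm _ _) _ _

lemma tendsto_integral_stress (hp : 1 < p)
    (hc : Continuous fun z : ℝ × E3 × ℝ≥0 => μ z.1 z.2.1 z.2.2)
    (hμ : ∀ o e d, 0 ≤ μ o e d ∧ μ o e d ≤ μ₁)
    (ho : AEStronglyMeasurable o ν) (he : AEStronglyMeasurable e ν)
    (ξ ζ η : Lp Mat3 (ENNReal.ofReal p) ν) :
    Tendsto (fun t : ℝ => ∫ x, inner ℝ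
        (stress μ p (o x) (e x) ((ξ + t • ζ : Lp Mat3 (ENNReal.ofReal p) ν) x)) (η x) ∂ν)
      (𝓝 0) (𝓝 (∫ x, inner ℝ (stress μ p (o x) (e x) (ξ x)) (η x) ∂ν)) := by
  have hμ₁ : 0 ≤ μ₁ := (hμ 0 0 0).1.trans (hμ 0 0 0).2
  have hcoe (t : ℝ) : (ξ + t • ζ : Lp Mat3 (ENNReal.ofReal p) ν) =ᵐ[ν] fun x => ξ x + t • ζ x := by
    filter_upwards [Lp.coeFn_add ξ (t • ζ), Lp.coeFn_smul t ζ] with x h1 h2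
    rw [h1, Pi.add_apply, h2, Pi.smul_apply]
  have heq (t : ℝ) : ∫ x, inner ℝ
      (stress μ p (o x) (e x) ((ξ + t • ζ : Lp Mat3 (ENNReal.ofReal p) ν) x)) (η x) ∂ν =
      ∫ x, inner ℝ (stress μ p (o x) (e x) (ξ x + t • ζ x)) (η x) ∂ν := by
    refine integral_congr_ae ?_
    filter_upwards [hcoe t] with x hx
    rw [hx]
  simp only [heq]
  -- For `|t| ≤ 1` the argument is at most `‖ξ x‖ + ‖ζ x‖`. The outer norm gives the dominating
  -- function the shape required by `integrable_norm_rpow_mul_norm`.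
  refine tendsto_integral_filter_of_dominated_convergence
    (fun x => 2 * μ₁ * (‖‖ξ x‖ + ‖ζ x‖‖ ^ (p - 1) * ‖η x‖)) ?_ ?_ ?_ ?_
  · exact Eventually.of_forall fun t => (aestronglyMeasurable_stress hc ho he
      ((Lp.aestronglyMeasurable ξ).add ((Lp.aestronglyMeasurable ζ).const_smul t))).inner
      (Lp.aestronglyMeasurable η)
  · filter_upwards [Metric.closedBall_mem_nhds (0 : ℝ) one_pos] with t ht
    refine ae_of_all _ fun x => (norm_inner_stress_le hp hμ _ _ _ _).trans ?_
    have h1 : ‖ξ x + t • ζ x‖ ≤ ‖‖ξ x‖ + ‖ζ x‖‖ := by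
      rw [Real.norm_of_nonneg (by positivity)]
      refine (norm_add_le _ _).trans ?_
      rw [norm_smul]
      have : ‖t‖ ≤ 1 := by simpa using ht
      nlinarith [norm_nonneg (ζ x)]
    have hp1 : 0 ≤ p - 1 := by linarith
    gcongr
  · exact (integrable_norm_rpow_mul_norm hp ((Lp.memLp ξ).norm.add (Lp.memLp ζ).norm)
      (Lp.memLp η)).const_mul _
  · refine ae_of_all _ fun x => ?_
    have h1 : Continuous fun t : ℝ => inner ℝ (stress μ p (o x) (e x) (ξ x + t • ζ x)) (η x) :=
      ((continuous_stress hp hμ (hc.comp (by fun_prop : Continuous fun d : ℝ≥0 => (o x, e x, d)))).comp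
        (by fun_prop : Continuous fun t : ℝ => ξ x + t • ζ x)).inner continuous_const
    simpa using h1.tendsto 0

end stressOp

/-! ### The operator on `V_{0.div}^p` -/

/-- The strain rate tensor as a continuous linear map of the gradient. -/
noncomputable def strainCLM : Mat3 →L[ℝ] Mat3 :=
  LinearMap.toContinuousLinearMap
    { toFun := strain
      map_add' := fun a b => by ext ij; simp [strain]; ring
      map_smul' := fun c a => by ext ij; simp [strain]; ring }

section symGrad

variable {p : ℝ} [Fact (1 < p)]

/-- The symmetric gradient `D(φ)` of a field in `W^{1,p}`. -/
noncomputable def symGrad {Ω : Set E3} : W1p p Ω →ₗ[ℝ] LpMat p Ω :=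
  (strainCLM.compLpL (ENNReal.ofReal p) (vol Ω)).toLinearMap ∘ₗ grad

lemma coeFn_symGrad {Ω : Set E3} (φ : W1p p Ω) :
    symGrad φ =ᵐ[vol Ω] fun x => strain (grad φ x) :=
  strainCLM.coeFn_compLpL (grad φ)

/-- The symmetric gradient on `V_{0.div}^p`. -/
noncomputable def symGradV {U : Set E2} {h : E2 → ℝ} : V0div p U h →L[ℝ] LpMat p (dom U h) :=
  -- The norm of `V0div` is the `L^p` norm of the gradient, so the bound for the pointwise map
  -- `strain` suffices.
  (symGrad ∘ₗ toW1p).mkContinuous ‖strainCLM.compLpL (ENNReal.ofReal p) (vol (dom U h))‖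
    fun φ => (strainCLM.compLpL (ENNReal.ofReal p) (vol (dom U h))).le_opNorm (grad (toW1p φ))

lemma symGradV_apply {U : Set E2} {h : E2 → ℝ} (φ : V0div p U h) :
    symGradV φ = symGrad (toW1p φ) := rfl

end symGrad

end FluidFlow

theorem corollary3p1
    (U : Set FluidFlow.E2) (hU_open : IsOpen U) (hU_conn : IsConnected U)
    (hU_bdd : Bornology.IsBounded U) (hU_lip : FluidFlow.HasLipschitzBoundary U)
    (h : FluidFlow.E2 → ℝ) (K : ℝ≥0) (hh_lip : LipschitzOnWith K h (closure U))
    (hmin hmax : ℝ) (hmin_pos : 0 < hmin) (hh_bdd : ∀ x ∈ closure U, hmin ≤ h x ∧ h x ≤ hmax)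
    (p : ℝ) [Fact (1 < p)] (q : ℝ) (hq : 1 ≤ q)
    (μ : ℝ → FluidFlow.E3 → ℝ≥0 → ℝ)
    (hμ_cont : Continuous fun z : ℝ × FluidFlow.E3 × ℝ≥0 => μ z.1 z.2.1 z.2.2)
    (hμ_mono : ∀ o e, Monotone (μ o e))
    (μ₀ μ₁ : ℝ) (hμ₀ : 0 < μ₀) (hμ_bdd : ∀ o e d, μ₀ ≤ μ o e d ∧ μ o e d ≤ μ₁)
    (G : FluidFlow.W1p p (FluidFlow.dom U h))
    (hG_div : FluidFlow.DivFree G)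
    (hG_top : FluidFlow.VanishesOn (FluidFlow.top U h) G)
    (hG_bot : FluidFlow.NormalVanishesOn (FluidFlow.bottom U h) FluidFlow.bottomNormal G)
    (θ : Lp ℝ (ENNReal.ofReal q) (volume.restrict (FluidFlow.dom U h)))
    (υ : FluidFlow.LpVec p (FluidFlow.dom U h)) :
    ∃ A : FluidFlow.V0div p U h → StrongDual ℝ (FluidFlow.V0div p U h),
      (∀ w φ : FluidFlow.V0div p U h,
        IntegrableOn (FluidFlow.flowIntegrand μ θ υ G w φ) (FluidFlow.dom U h) ∧
        A w φ = ∫ x in FluidFlow.dom U h, FluidFlow.flowIntegrand μ θ υ G w φ x) ∧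
      FluidFlow.IsBoundedOperator A ∧ FluidFlow.IsPseudoMonotone A := by
  open FluidFlow in
  have hp : 1 < p := Fact.out
  have hμ : ∀ o e d, 0 ≤ μ o e d ∧ μ o e d ≤ μ₁ := fun o e d =>
    ⟨hμ₀.le.trans (hμ_bdd o e d).1, (hμ_bdd o e d).2⟩
  have hμ₁ : 0 ≤ μ₁ := (hμ 0 0 0).1.trans (hμ 0 0 0).2
  have ho := Lp.aestronglyMeasurable θ
  have he := Lp.aestronglyMeasurable (υ + fld G)
  obtain ⟨N, hN, hNle⟩ := exists_stressOp (p := p) hμ_cont hμ ho he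
  -- `N` sees representatives of `L^p` classes, whereas `flowIntegrand` applies `strain` pointwise;
  -- they agree only almost everywhere.
  have hae : ∀ w φ : V0div p U h, (fun x => inner ℝ (stress μ p (θ x) ((υ + fld G) x)
      ((symGradV w + symGrad G : LpMat p (dom U h)) x)) (symGradV φ x)) =ᵐ[vol (dom U h)]
      flowIntegrand μ θ υ G w φ := by
    intro w φ
    have hw := coeFn_symGrad (toW1p w + G)
    rw [map_add, ← symGradV_apply] at hw
    filter_upwards [hw, coeFn_symGrad (toW1p φ)] with x h1 h2
    rw [flowIntegrand, h1, symGradV_apply, h2]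
  refine ⟨fun w => (N (symGradV w + symGrad G)).comp symGradV, fun w φ => ⟨?_, ?_⟩, ?_, ?_⟩
  · exact (integrable_inner_stress hp hμ_cont hμ ho he (Lp.memLp _) (Lp.memLp _)).congr (hae w φ)
  · rw [ContinuousLinearMap.comp_apply, hN]
    exact integral_congr_ae (hae w φ)
  · intro S hS
    obtain ⟨R, hR⟩ := hS.exists_norm_le
    have hp1 : 0 ≤ p - 1 := by linarith
    refine isBounded_iff_forall_norm_le.2 ⟨2 * μ₁ *
      (‖(symGradV : V0div p U h →L[ℝ] LpMat p (dom U h))‖ * R + ‖symGrad G‖) ^ (p - 1) *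
      ‖(symGradV : V0div p U h →L[ℝ] LpMat p (dom U h))‖, ?_⟩
    rintro _ ⟨w, hw, rfl⟩
    refine (ContinuousLinearMap.opNorm_comp_le _ _).trans ?_
    gcongr
    refine (hNle _).trans ?_
    gcongr
    refine (norm_add_le _ _).trans ?_
    gcongr
    exact (symGradV.le_opNorm w).trans (by gcongr; exact hR w hw)
  · refine isPseudoMonotone_of_monotone (fun u v => ?_) (fun u v φ => ?_)
    · have h1 := integral_stress_monotone hp hμ_cont hμ hμ_mono ho he
        (symGradV u + symGrad G) (symGradV v + symGrad G)
      -- The shift by `symGrad G` cancels in the difference, so monotonicity of `N` passes to the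
      -- composite.
      rw [add_sub_add_right_eq_sub, ← map_sub, ← hN, ← hN] at h1
      exact h1
    · have h1 := tendsto_integral_stress hp hμ_cont hμ ho he
        (symGradV u + symGrad G) (symGradV v) (symGradV φ)
      simp only [← hN] at h1
      refine (h1.mono_left nhdsWithin_le_nhds).congr fun t => ?_
      rw [ContinuousLinearMap.comp_apply, map_add, map_smul, add_right_comm]
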